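/- \textbf{Setting.} Applications $i=1,\dots,n$ share $\kappa\ge 1$ CPUs ($\kappa\in\mathbb N$). Application $i$ has a weight $\lambda_i\in(0,1]$, a minimum service level $\underline s_i>0$, a constant $\beta_i>0$ and the matching function $\varphi_i(s_i,v_i)=\beta_i v_i/s_i-1$. Service levels satisfy $s_i\in[\underline s_i,\infty)$, and normalized bandwidths $\bar v_i=v_i/\kappa$ are feasible: $\bar v_i\in[0,1/\kappa]$ and $\sum_i\bar v_i\le 1$. Write $[x]_-=\min\{x,0\}$ and $$\Phi_i(\mathbf s,\kappa\bar{\mathbf v})=-(1-\bar v_i)\lambda_i[\varphi_i(s_i,\kappa\bar v_i)]_-+\bar v_i\sum_{j\ne i}\lambda_j[\varphi_j(s_j,\kappa\bar v_j)]_- .$$ Consider the projected ODE $(\dot s_i,\dot{\bar v}_i)=(\varphi_i(s_i,\kappa\bar v_i),\Phi_i(\mathbf s,\kappa\bar{\mathbf v}))+\mathbf z_i$, where $\mathbf z_i$ is the shortest vector that keeps $s_i$ in $[\underline s_i,\infty)$ and $\bar v_i$ in $[0,1/\kappa]$. Its stationary points are taken among the feasible states. The synchronous recursion with step size $\epsilon>0$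 is $$s_i(t_{k+1})=\Pi_{[\underline s_i,\infty)}[s_i(t_k)+\epsilon\varphi_i],\qquad \bar v_i(t_{k+1})=\Pi_{[0,1/\kappa]}[\bar v_i(t_k)+\epsilon\Phi_i],$$ with $\varphi_i$ and $\Phi_i$ evaluated at $t_k$, where $\Pi$ denotes projection. \textbf{Asynchronous recursion.} The resource manager updates at instants $0=t_0<t_1<\cdots\to\infty$ and application $i$ at instants $0\le t^i_0<t^i_1<\cdots$. For $t\ge0$ let $\bar m(t)$ be the index with $t_{\bar m(t)}\le t<t_{\bar m(t)+1}$, and let $N_i(k)=\bar m(t^i_{k+1})-\bar m(t^i_k)$. Assume $1\le N_i(k)\le\bar N$ for all $i,k$. Application $i$ has service level $s_i(t)=s_i(t^i_k)$ on $[t^i_k,t^i_{k+1})$, and $s_i(t)=s_i(t_0^i)$ on $[0,t^i_0)$. Put $f_i(t_m)=\varphi_i(s_i(t_m),\kappa\bar v_i(t_m))$. The updates are $$s_i(t^i_{k+1})=\Pi_{[\underline s_i,\infty)}\big[s_i(t^i_k)+\epsilon N_i(k) f_i(t_{\bar m(t^i_k)})\big],\qquad \bar v_i(t_{m+1})=\Pi_{[0,1/\kappa]}\big[\bar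 v_i(t_m)+\epsilon F_i(t_m)\big],$$ $$F_i(t_m)=-(1-\bar v_i(t_m))\lambda_i[f_i(t_m)]_-+\bar v_i(t_m)\sum_{j\neq i}\lambda_j[f_j(t_m)]_-,$$ from any initial service levels in $\prod_i[\underline s_i,\infty)$ and any feasible $\bar{\mathbf v}(t_0)$. \textbf{Hypotheses.} (H1): $\beta_i/\underline s_i<1$ for all $i$. (H2): there is $0<\zeta\le1/\kappa$ with $\beta_i\kappa\zeta/\underline s_i<1$ for all $i$ such that, for all sufficiently small $\epsilon>0$, every trajectory of the synchronous recursion (with admissible service levels and feasible bandwidths initially) and every $i$ satisfy: if $\bar v_i(t_0)>\zeta$, then $\bar v_i(t_k)\le\zeta$ for some finite $k$; if $\bar v_i(t_0)\le\zeta$, then $\bar v_i(t_k)\le\zeta$ for all $k$. \textbf{Theorem (Asynchronous convergence).} 1. Under (H1) or (H2) the ODE has a stationary point, and every stationary point $(\mathbf s^*,\bar{\mathbf v}^*)$ satisfies, for all $i$: $s_i^*=\underline s_i$, and either $\Phi_i(\mathbf s^*,\kappa\bar{\mathbf v}^*)=0$, or $\Phi_i(\mathbf s^*,\kappa\bar{\mathbf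 v}^*)>0$ and $\bar v_i^*=1/\kappa$. 2. Suppose either (i) $n$ is fixed and $\beta_i\kappa/\underline s_i\to0$ for all $i$, or (ii) $n\to\infty$ while $\lambda_i\ge\underline\lambda$ and $\beta_i\kappa/\underline s_i\le A$ for all $i$, for some constants $\underline\lambda>0$ and $A$. Then, as soon as all the $\beta_i\kappa/\underline s_i$ are small enough (in terms of $n$), respectively $n$ is large enough (in terms of $\underline\lambda,A$), the ODE has a unique stationary point $(\mathbf s^*,\bar{\mathbf v}^*)$, and: (a) $s_i^*=\underline s_i$, and $\bar v_i^*\to\min\{1/\kappa,\ \lambda_i/\sum_j\lambda_j\}$ in this limit, uniformly in $i$ and in the remaining parameters; in case (ii), where this minimum itself tends to $0$, this means that the ratio of the two sides tends to $1$; (b) for every $\bar N$ there is $\epsilon_0>0$ such that for every step size $0<\epsilon<\epsilon_0$, every schedule of update instants as above and every initial condition, the asynchronous recursion satisfies $s_i(t^i_k)\to s_i^*$ as $k\to\infty$ and $\bar v_i(t_m)\to\bar v_i^*$ as $m\to\infty$, for all $i$. -/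

import Mathlib

open Filter Topology

noncomputable section

/-- Data of `n` applications sharing `kappa` CPUs: the positive constants `beta i` of the nominal
matching functions, the minimum service levels `smin i > 0`, and the weights `lam i ∈ (0, 1]`. -/
structure CPUSystem (n : ℕ) where
  kappa : ℕ
  beta : Fin n → ℝ
  smin : Fin n → ℝ
  lam : Fin n → ℝ
  kappa_pos : 0 < kappa
  beta_pos : ∀ i, 0 < beta i
  smin_pos : ∀ i, 0 < smin i
  lam_pos : ∀ i, 0 < lam i
  lam_le_one : ∀ i, lam i ≤ 1

/-- `[x]₋`: equal to `x` if `x ≤ 0`, and to `0` otherwise. -/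
def negTrunc (x : ℝ) : ℝ := if x ≤ 0 then x else 0

/-- Index of the last term of the (increasing) sequence of instants `t` which is `≤ x`,
i.e. the `k` with `t k ≤ x < t (k + 1)`; it is `0` before the first instant. -/
def lastIndex (t : ℕ → ℝ) (x : ℝ) : ℕ := sSup {k : ℕ | t k ≤ x}

namespace CPUSystem

variable {n : ℕ} (P : CPUSystem n)

/-- Nominal matching function `φᵢ(s, v) = βᵢ v / s - 1` (`v` is the bandwidth, not normalized). -/
def matching (i : Fin n) (s v : ℝ) : ℝ := P.beta i * (v / s) - 1

/-- Fairness measure of application `i` for the normalized allocation `vbar` and the values `f j`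
of the matching functions. -/
def fairness (vbar f : Fin n → ℝ) (i : Fin n) : ℝ :=
  -(1 - vbar i) * P.lam i * negTrunc (f i)
    + vbar i * ∑ j ∈ Finset.univ.erase i, P.lam j * negTrunc (f j)

/-- Nominal fairness measure `Φᵢ(s, v)`, as a function of the bandwidths `v` (not normalized). -/
def Phi (s v : Fin n → ℝ) (i : Fin n) : ℝ :=
  P.fairness (fun j => v j / P.kappa) (fun j => P.matching j (s j) (v j)) i

/-- Admissible service level profile: `s i ∈ [smin i, ∞)`. -/
def Admissible (s : Fin n → ℝ) : Prop := ∀ i, P.smin i ≤ s i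

/-- Feasible normalized allocation: `vbar i ∈ [0, 1/κ]` and `∑ vbar i ≤ 1`, i.e. the bandwidths
`v = κ vbar` lie in `[0, 1]` and sum up to at most `κ`. -/
def Feasible (vbar : Fin n → ℝ) : Prop :=
  (∀ i, 0 ≤ vbar i ∧ vbar i ≤ 1 / P.kappa) ∧ ∑ i, vbar i ≤ 1

/-- Projection onto `[smin i, ∞)`. -/
def projS (i : Fin n) (x : ℝ) : ℝ := max (P.smin i) x

/-- Projection onto `[0, 1/κ]`. -/
def projV (x : ℝ) : ℝ := max 0 (min (1 / P.kappa) x)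

/-! ### The projected ODE -/

/-- Shortest correction of the velocity `x` of the service level of `i` at `si` that keeps it in
`[smin i, ∞)`. -/
def zS (i : Fin n) (si x : ℝ) : ℝ := if si = P.smin i then max (-x) 0 else 0

/-- Shortest correction of the velocity `x` of a normalized bandwidth at `vi` that keeps it in
`[0, 1/κ]`. -/
def zV (vi x : ℝ) : ℝ :=
  if vi = 0 then max (-x) 0 else if vi = 1 / P.kappa then -max x 0 else 0

/-- Right-hand side of the ODE for the service level of `i`. -/
def odeS (s vbar : Fin n → ℝ) (i : Fin n) : ℝ :=
  P.matching i (s i) (P.kappa * vbar i) + P.zS i (s i) (P.matching i (s i) (P.kappa * vbar i))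

/-- Right-hand side of the ODE for the normalized bandwidth of `i`. -/
def odeV (s vbar : Fin n → ℝ) (i : Fin n) : ℝ :=
  P.Phi s (fun j => P.kappa * vbar j) i + P.zV (vbar i) (P.Phi s (fun j => P.kappa * vbar j) i)

/-- `(s, vbar)` is a (feasible) stationary point of the ODE. -/
def IsStationary (s vbar : Fin n → ℝ) : Prop :=
  P.Admissible s ∧ P.Feasible vbar ∧ ∀ i, P.odeS s vbar i = 0 ∧ P.odeV s vbar i = 0

/-- Stationarity conditions: minimum service level, and fair or limited by the size of a core. -/
def FairOrSaturated (s vbar : Fin n → ℝ) : Prop :=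
  ∀ i, s i = P.smin i ∧
    (P.Phi s (fun j => P.kappa * vbar j) i = 0 ∨
      (0 < P.Phi s (fun j => P.kappa * vbar j) i ∧ vbar i = 1 / P.kappa))

/-- The target share `min {1/κ, λᵢ / ∑ⱼ λⱼ}`. -/
def share (i : Fin n) : ℝ := min (1 / P.kappa) (P.lam i / ∑ j, P.lam j)

/-! ### Synchronous recursion and the two overload hypotheses -/

/-- `s`, `vbar` follow the synchronous recursion with step size `ε`, from an admissible and
feasible initial condition. -/
structure IsSyncTrajectory (ε : ℝ) (s vbar : ℕ → Fin n → ℝ) : Prop where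
  init_s : P.Admissible (s 0)
  init_v : P.Feasible (vbar 0)
  step_s : ∀ k i, s (k + 1) i =
    P.projS i (s k i + ε * P.matching i (s k i) (P.kappa * vbar k i))
  step_v : ∀ k i, vbar (k + 1) i =
    P.projV (vbar k i + ε * P.Phi (s k) (fun j => P.kappa * vbar k j) i)

/-- Hypothesis (H1): highly demanding applications. -/
def H1 : Prop := ∀ i, P.beta i / P.smin i < 1

/-- Hypothesis (H2): there is a level `ζ ∈ (0, 1/κ]`, at or below which every matching function is
negative, such that, for all small step sizes, every normalized bandwidth that starts above `ζ`
gets to at most `ζ` in finitely many steps, and one that starts at or below `ζ` stays there. -/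
def H2 : Prop :=
  ∃ ζ : ℝ, 0 < ζ ∧ ζ ≤ 1 / P.kappa ∧ (∀ i, P.beta i * P.kappa * ζ / P.smin i - 1 < 0) ∧
    ∃ ε₀ : ℝ, 0 < ε₀ ∧ ∀ ε : ℝ, 0 < ε → ε < ε₀ →
      ∀ s vbar : ℕ → Fin n → ℝ, P.IsSyncTrajectory ε s vbar → ∀ i,
        (ζ < vbar 0 i → ∃ k, vbar k i ≤ ζ) ∧ (vbar 0 i ≤ ζ → ∀ k, vbar k i ≤ ζ)

end CPUSystem

/-! ### Asynchronous updates -/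

/-- `N_i(k)`: number of updates of the resource manager (at the instants `rm`) between the
consecutive updates `app k`, `app (k + 1)` of an application. -/
def numUpdates (rm app : ℕ → ℝ) (k : ℕ) : ℕ :=
  lastIndex rm (app (k + 1)) - lastIndex rm (app k)

/-- Update instants: `rm m` of the resource manager, starting at `0` and going on forever, and
`app i k` of the applications, such that `1 ≤ N_i(k) ≤ Nbar`. -/
structure IsSchedule {n : ℕ} (Nbar : ℕ) (rm : ℕ → ℝ) (app : Fin n → ℕ → ℝ) : Prop where
  rm_zero : rm 0 = 0
  rm_strictMono : StrictMono rm
  rm_tendsto : Tendsto rm atTop atTop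
  app_nonneg : ∀ i, 0 ≤ app i 0
  app_strictMono : ∀ i, StrictMono (app i)
  one_le_numUpdates : ∀ i k, 1 ≤ numUpdates rm (app i) k
  numUpdates_le : ∀ i k, numUpdates rm (app i) k ≤ Nbar

namespace CPUSystem

variable {n : ℕ} (P : CPUSystem n)

/-- Matching function `f_i(t_m)` measured by the resource manager at its update `m`. Here `s i k`
is the service level of `i` during `[app i k, app i (k + 1))`, with `s i 0` also before, and
`vbar m` is the normalized allocation during `[rm m, rm (m + 1))`. -/
def observed (rm : ℕ → ℝ) (app : Fin n → ℕ → ℝ) (s : Fin n → ℕ → ℝ) (vbar : ℕ → Fin n → ℝ)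
    (m : ℕ) (i : Fin n) : ℝ :=
  P.matching i (s i (lastIndex (app i) (rm m))) (P.kappa * vbar m i)

/-- `s`, `vbar` follow the asynchronous recursion with step size `ε`, from an admissible and
feasible initial condition: application `i` uses the latest measurement of the resource manager
at `app i k`, multiplied by `N_i(k)`. -/
structure IsAsyncTrajectory (rm : ℕ → ℝ) (app : Fin n → ℕ → ℝ) (ε : ℝ)
    (s : Fin n → ℕ → ℝ) (vbar : ℕ → Fin n → ℝ) : Prop where
  init_s : P.Admissible (fun i => s i 0)
  init_v : P.Feasible (vbar 0)
  step_s : ∀ i k, s i (k + 1) =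
    P.projS i (s i k + ε * ((numUpdates rm (app i) k : ℝ)
      * P.observed rm app s vbar (lastIndex rm (app i k)) i))
  step_v : ∀ m i, vbar (m + 1) i =
    P.projV (vbar m i + ε * P.fairness (vbar m) (P.observed rm app s vbar m) i)

/-- For every `Nbar` and every sufficiently small step size, all trajectories of the asynchronous
recursion converge to `(sStar, vStar)`, whatever the schedule and the initial condition. -/
def AsyncConvergesTo (sStar vStar : Fin n → ℝ) : Prop :=
  ∀ Nbar : ℕ, ∃ ε₀ : ℝ, 0 < ε₀ ∧ ∀ ε : ℝ, 0 < ε → ε < ε₀ →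
    ∀ (rm : ℕ → ℝ) (app : Fin n → ℕ → ℝ), IsSchedule Nbar rm app →
      ∀ (s : Fin n → ℕ → ℝ) (vbar : ℕ → Fin n → ℝ), P.IsAsyncTrajectory rm app ε s vbar →
        ∀ i, Tendsto (s i) atTop (𝓝 (sStar i)) ∧
          Tendsto (fun m => vbar m i) atTop (𝓝 (vStar i))

end CPUSystem

end

/-! Write `d i = -λ i [f i]₋` for the deficit of an application and `G` for the total deficit. Then
the fairness measure is `d i - vbar i * G`, so the applications interact only through the scalar
`G`.

At a stationary point with `G > 0`, every matching function is negative. This forces the minimum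
service level and determines the allocation as an explicit function `alloc G` of `G`. Summing the
deficits of `alloc G` gives back `G` exactly when `deficitRatio G = 1`. Strict monotonicity of
`deficitRatio` yields uniqueness. Existence follows from the intermediate value theorem, or, if the
ratio stays below 1 near 0, from an allocation meeting every demand exactly.

Both asymptotic regimes are instances of `Overloaded`, where `G` is bounded below by `gap`.
Convergence then has three stages. Bandwidths above `ζ` lose a fixed amount per step
(`Overloaded.step_le`), so all end up at or below `ζ`. There the matching functions are at most
`-1/2`, so each service level reaches its minimum after finitely many updates. From then on
measurement lags are invisible and the bandwidths follow an autonomous recursion that contracts in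
the sup norm (`Overloaded.abs_step_sub_le`). -/

noncomputable section

open Finset

namespace CPUSystem

variable {n : ℕ} (P : CPUSystem n)

/-- Value `βᵢ κ / smin i` of `φᵢ + 1` at the minimum service level and `vbar = 1`. -/
def load (i : Fin n) : ℝ := P.beta i * P.kappa / P.smin i

/-- Weighted lack of bandwidth `-λᵢ [fᵢ]₋`. -/
def deficit (f : Fin n → ℝ) (i : Fin n) : ℝ := -(P.lam i * negTrunc (f i))

/-- Values of the matching functions at service levels `s` and normalized allocation `vbar`. -/
def matchings (s vbar : Fin n → ℝ) (j : Fin n) : ℝ := P.matching j (s j) (P.kappa * vbar j)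

/-! ### Deficits and bounds on the matching functions. -/

lemma kappa_cast_pos : (0 : ℝ) < P.kappa := Nat.cast_pos.2 P.kappa_pos

lemma one_div_kappa_pos : 0 < 1 / (P.kappa : ℝ) := one_div_pos.2 P.kappa_cast_pos

lemma load_pos (i : Fin n) : 0 < P.load i :=
  div_pos (mul_pos (P.beta_pos i) P.kappa_cast_pos) (P.smin_pos i)

lemma deficit_nonneg (f : Fin n → ℝ) (i : Fin n) : 0 ≤ P.deficit f i := by
  have := P.lam_pos i
  unfold deficit negTrunc
  split_ifs <;> nlinarith

lemma deficit_le {f : Fin n → ℝ} {i : Fin n} (h : -1 ≤ f i) : P.deficit f i ≤ P.lam i := by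
  have := P.lam_pos i
  unfold deficit negTrunc
  split_ifs <;> nlinarith

lemma deficit_of_nonpos {f : Fin n → ℝ} {i : Fin n} (h : f i ≤ 0) :
    P.deficit f i = -(P.lam i * f i) := by
  simp [deficit, negTrunc, h]

lemma le_deficit (f : Fin n → ℝ) (i : Fin n) : -(P.lam i * f i) ≤ P.deficit f i := by
  have := P.lam_pos i
  unfold deficit negTrunc
  split_ifs <;> nlinarith

/-- Moving the own term of `i` into the sum absorbs the factor `1 - vbar i`. -/
lemma fairness_eq (vbar f : Fin n → ℝ) (i : Fin n) :
    P.fairness vbar f i = P.deficit f i - vbar i * ∑ j, P.deficit f j := by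
  have h1 : ∑ j, P.deficit f j
      = -(P.lam i * negTrunc (f i) + ∑ j ∈ univ.erase i, P.lam j * negTrunc (f j)) := by
    rw [Finset.add_sum_erase univ (fun j => P.lam j * negTrunc (f j)) (mem_univ i)]
    simp [deficit]
  rw [h1]
  unfold fairness deficit
  ring

lemma Phi_eq (s vbar : Fin n → ℝ) (i : Fin n) :
    P.Phi s (fun j => P.kappa * vbar j) i
      = P.deficit (P.matchings s vbar) i - vbar i * ∑ j, P.deficit (P.matchings s vbar) j := by
  have hk := P.kappa_cast_pos.ne'
  rw [← fairness_eq]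
  simp [Phi, hk]
  rfl

lemma matching_smin (i : Fin n) (v : ℝ) :
    P.matching i (P.smin i) (P.kappa * v) = P.load i * v - 1 := by
  unfold matching load
  ring

lemma matching_le {i : Fin n} {s v : ℝ} (hs : P.smin i ≤ s) (hv : 0 ≤ v) :
    P.matching i s (P.kappa * v) ≤ P.load i * v - 1 := by
  rw [← matching_smin]
  unfold matching
  have := P.beta_pos i
  have := P.smin_pos i
  have := P.kappa_cast_pos
  gcongr

lemma neg_one_le_matching {i : Fin n} {s v : ℝ} (hs : P.smin i ≤ s) (hv : 0 ≤ v) :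
    -1 ≤ P.matching i s (P.kappa * v) := by
  unfold matching
  have h1 := P.beta_pos i
  have h2 := P.smin_pos i
  have h3 := P.kappa_cast_pos
  have h4 : 0 < s := h2.trans_le hs
  have : 0 ≤ P.beta i * (P.kappa * v / s) := by positivity
  linarith

lemma neg_one_le_matchings {s vbar : Fin n → ℝ} (hs : P.Admissible s) (hv : P.Feasible vbar)
    (i : Fin n) : -1 ≤ P.matchings s vbar i :=
  P.neg_one_le_matching (hs i) (hv.1 i).1

/-! ### Stationary points -/

variable {P}

lemma IsStationary.projS_eq {s vbar : Fin n → ℝ} (h : P.IsStationary s vbar) {ε : ℝ} (hε : 0 < ε)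
    (i : Fin n) : P.projS i (s i + ε * P.matching i (s i) (P.kappa * vbar i)) = s i := by
  have h1 := h.1 i
  have h2 := (h.2.2 i).1
  unfold odeS zS at h2
  unfold projS
  generalize P.matching i (s i) (P.kappa * vbar i) = f at *
  split_ifs at h2 with h3
  · have : f ≤ 0 := by linarith [le_max_right (-f) 0]
    rw [← h3]
    exact max_eq_left (by nlinarith)
  · have : f = 0 := by linarith
    subst this
    simpa using h1

lemma IsStationary.Phi_cases {s vbar : Fin n → ℝ} (h : P.IsStationary s vbar) (i : Fin n) :
    (vbar i = 0 ∧ P.Phi s (fun j => P.kappa * vbar j) i ≤ 0) ∨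
      P.Phi s (fun j => P.kappa * vbar j) i = 0 ∨
      (0 < P.Phi s (fun j => P.kappa * vbar j) i ∧ vbar i = 1 / P.kappa) := by
  have h2 := (h.2.2 i).2
  unfold odeV zV at h2
  generalize P.Phi s (fun j => P.kappa * vbar j) i = f at *
  split_ifs at h2 with h3 h4
  · exact Or.inl ⟨h3, by linarith [le_max_right (-f) 0]⟩
  · rcases (show 0 ≤ f by linarith [le_max_right f 0]).eq_or_lt with h5 | h5
    · exact Or.inr (Or.inl h5.symm)
    · exact Or.inr (Or.inr ⟨h5, h4⟩)
  · exact Or.inr (Or.inl (by linarith))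

lemma IsStationary.projV_eq {s vbar : Fin n → ℝ} (h : P.IsStationary s vbar) {ε : ℝ} (hε : 0 < ε)
    (i : Fin n) : P.projV (vbar i + ε * P.Phi s (fun j => P.kappa * vbar j) i) = vbar i := by
  have h1 := h.2.1.1 i
  have hk := P.one_div_kappa_pos
  have h2 := h.Phi_cases i
  unfold projV
  generalize P.Phi s (fun j => P.kappa * vbar j) i = f at *
  rcases h2 with ⟨h3, h4⟩ | h3 | ⟨h3, h4⟩
  · rw [h3]
    exact max_eq_left (min_le_of_right_le (by nlinarith))
  · simp only [h3, mul_zero, add_zero]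
    rw [min_eq_right h1.2, max_eq_right h1.1]
  · rw [h4, min_eq_left (by nlinarith), max_eq_right hk.le]

/-- A nonnegative matching function would mean zero deficit and `vbar i > 0`, hence negative drift
`-vbar i * G` away from the lower bound. A negative one pushes the service level to its minimum, and
makes the drift positive at `vbar i = 0`. -/
lemma IsStationary.eq_smin {s vbar : Fin n → ℝ} (h : P.IsStationary s vbar)
    (hG : 0 < ∑ j, P.deficit (P.matchings s vbar) j) (i : Fin n) :
    s i = P.smin i ∧ 0 < vbar i ∧ P.matchings s vbar i < 0 := by
  have hpos : ∀ h0 : 0 ≤ P.matchings s vbar i, False := by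
    intro h0
    have hd : P.deficit (P.matchings s vbar) i = 0 := by
      unfold deficit negTrunc
      split_ifs with h5
      · simp [le_antisymm h5 h0]
      · simp
    have hv : vbar i ≠ 0 := by
      intro hv
      simp [matchings, matching, hv] at h0
      linarith
    have hv' : 0 < vbar i := lt_of_le_of_ne (h.2.1.1 i).1 hv.symm
    have := h.Phi_cases i
    rw [Phi_eq, hd] at this
    rcases this with ⟨h3, _⟩ | h3 | ⟨h3, _⟩
    · exact hv h3
    · nlinarith
    · nlinarith
  have hneg : P.matchings s vbar i < 0 := not_le.1 hpos
  refine ⟨?_, lt_of_le_of_ne (h.2.1.1 i).1 fun hv => ?_, hneg⟩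
  · have h2 := (h.2.2 i).1
    unfold odeS zS at h2
    split_ifs at h2 with h3
    · exact h3
    · unfold matchings at hneg
      linarith
  · have hd := P.deficit_of_nonpos hneg.le
    have := h.Phi_cases i
    rw [Phi_eq, hd, ← hv] at this
    have hl := P.lam_pos i
    rcases this with ⟨_, h3⟩ | h3 | ⟨_, h3⟩
    · nlinarith
    · nlinarith
    · linarith [P.one_div_kappa_pos]

lemma IsStationary.fairOrSaturated {s vbar : Fin n → ℝ} (h : P.IsStationary s vbar)
    (hG : 0 < ∑ j, P.deficit (P.matchings s vbar) j) : P.FairOrSaturated s vbar := fun i =>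
  ⟨(h.eq_smin hG i).1, (h.Phi_cases i).resolve_left fun h0 => (h.eq_smin hG i).2.1.ne' h0.1⟩

lemma IsStationary.fairOrSaturated_of_matchings_neg {s vbar : Fin n → ℝ}
    (h : P.IsStationary s vbar) (hf : ∀ i, P.matchings s vbar i < 0) :
    P.FairOrSaturated s vbar := by
  intro i
  refine h.fairOrSaturated (Finset.sum_pos (fun j _ => ?_) ⟨i, mem_univ i⟩) i
  rw [P.deficit_of_nonpos (hf j).le]
  nlinarith [P.lam_pos j, hf j]

/-- A stationary point is a constant synchronous trajectory. -/
lemma IsStationary.isSyncTrajectory {s vbar : Fin n → ℝ} (h : P.IsStationary s vbar) {ε : ℝ}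
    (hε : 0 < ε) : P.IsSyncTrajectory ε (fun _ => s) (fun _ => vbar) where
  init_s := h.1
  init_v := h.2.1
  step_s _ i := (h.projS_eq hε i).symm
  step_v _ i := (h.projV_eq hε i).symm

/-- Under `H2`, a constant trajectory starting above `ζ` could never get down to `ζ`, so a
stationary allocation lies at or below it. -/
lemma IsStationary.matchings_neg {s vbar : Fin n → ℝ} (h : P.IsStationary s vbar)
    (hP : P.H1 ∨ P.H2) (i : Fin n) : P.matchings s vbar i < 0 := by
  have hle := P.matching_le (h.1 i) (h.2.1.1 i).1
  have hb := P.load_pos i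
  rcases hP with hP | ⟨ζ, -, -, hζ, ε₀, hε₀, H⟩
  · have h1 : P.load i * vbar i ≤ P.load i * (1 / P.kappa) :=
      mul_le_mul_of_nonneg_left (h.2.1.1 i).2 hb.le
    have h2 : P.load i * (1 / P.kappa) = P.beta i / P.smin i := by
      have := P.kappa_cast_pos.ne'
      unfold load
      field_simp
    have := hP i
    unfold matchings
    linarith
  · have h1 : vbar i ≤ ζ := by
      by_contra hlt
      obtain ⟨k, hk⟩ := (H (ε₀ / 2) (by linarith) (by linarith) _ _
        (h.isSyncTrajectory (half_pos hε₀)) i).1 (not_le.1 hlt)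
      exact hlt hk
    have h2 : P.load i * vbar i ≤ P.load i * ζ := mul_le_mul_of_nonneg_left h1 hb.le
    have h3 : P.load i * ζ = P.beta i * P.kappa * ζ / P.smin i := by
      unfold load
      ring
    have := hζ i
    unfold matchings
    linarith

/-! ### The scalar equation for the total deficit: uniqueness and existence. -/

variable (P)

/-- Allocation of `i` at the minimum service level when the total deficit is `x`. -/
def alloc (x : ℝ) (i : Fin n) : ℝ := min (1 / P.kappa) (P.lam i / (x + P.lam i * P.load i))

/-- Total deficit under the allocation `alloc x`, divided by `x`. -/
def deficitRatio (x : ℝ) : ℝ :=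
  ∑ i, max (P.lam i * (1 - P.load i / P.kappa) / x) (P.lam i / (x + P.lam i * P.load i))

variable {P}

lemma deficit_alloc {x : ℝ} (hx : 0 < x) (i : Fin n) :
    P.lam i * (1 - P.load i * P.alloc x i)
      = x * max (P.lam i * (1 - P.load i / P.kappa) / x) (P.lam i / (x + P.lam i * P.load i)) := by
  have h1 := P.lam_pos i
  have h2 := P.load_pos i
  have h3 : 0 < x + P.lam i * P.load i := by positivity
  have h4 := P.kappa_cast_pos
  have h5 : P.lam i * (1 - P.load i * (P.lam i / (x + P.lam i * P.load i)))
      = x * (P.lam i / (x + P.lam i * P.load i)) := by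
    field_simp
    ring
  rw [mul_max_of_nonneg _ _ hx.le, mul_div_cancel₀ _ hx.ne', ← h5, alloc, ← mul_one_div (P.load i)]
  rcases le_total (1 / (P.kappa : ℝ)) (P.lam i / (x + P.lam i * P.load i)) with h6 | h6
  · rw [min_eq_left h6, max_eq_left (by gcongr)]
  · rw [min_eq_right h6, max_eq_right (by gcongr)]

lemma IsStationary.eq_alloc {s vbar : Fin n → ℝ} (h : P.IsStationary s vbar)
    (hG : 0 < ∑ j, P.deficit (P.matchings s vbar) j) (i : Fin n) :
    P.deficit (P.matchings s vbar) i = P.lam i * (1 - P.load i * vbar i) ∧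
      vbar i = P.alloc (∑ j, P.deficit (P.matchings s vbar) j) i := by
  obtain ⟨h1, h2, h3⟩ := h.eq_smin hG i
  have hd : P.deficit (P.matchings s vbar) i = P.lam i * (1 - P.load i * vbar i) := by
    rw [P.deficit_of_nonpos h3.le, matchings, h1, matching_smin]
    ring
  refine ⟨hd, ?_⟩
  have hP := (h.fairOrSaturated hG i).2
  have hv := (h.2.1.1 i).2
  rw [Phi_eq, hd] at hP
  generalize ∑ j, P.deficit (P.matchings s vbar) j = G at *
  have hl := P.lam_pos i
  have hb := P.load_pos i
  have h4 : 0 < G + P.lam i * P.load i := by positivity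
  unfold alloc
  rcases hP with hP | ⟨hP, hk⟩
  · have : vbar i = P.lam i / (G + P.lam i * P.load i) := by
      rw [eq_div_iff h4.ne']
      linarith
    rw [← this, min_eq_right hv]
  · rw [← hk, min_eq_left]
    rw [le_div_iff₀ h4]
    linarith

lemma deficitRatio_eq_one {s vbar : Fin n → ℝ} (h : P.IsStationary s vbar)
    (hG : 0 < ∑ j, P.deficit (P.matchings s vbar) j) :
    P.deficitRatio (∑ j, P.deficit (P.matchings s vbar) j) = 1 := by
  have h1 : ∑ i, P.deficit (P.matchings s vbar) i
      = (∑ j, P.deficit (P.matchings s vbar) j)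
        * P.deficitRatio (∑ j, P.deficit (P.matchings s vbar) j) := by
    conv_lhs => rw [Finset.sum_congr rfl fun i _ => (h.eq_alloc hG i).1]
    rw [deficitRatio, mul_sum]
    refine sum_congr rfl fun i _ => ?_
    rw [← deficit_alloc hG, ← (h.eq_alloc hG i).2]
  exact mul_left_cancel₀ hG.ne' (by linarith)

lemma deficitRatio_lt [Nonempty (Fin n)] {x y : ℝ} (hx : 0 < x) (hxy : x < y) :
    P.deficitRatio y < P.deficitRatio x := by
  refine sum_lt_sum_of_nonempty univ_nonempty fun i _ => ?_
  have h1 := P.lam_pos i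
  have h2 := P.load_pos i
  have h3 : 0 < P.lam i * P.load i := by positivity
  have h4 : P.lam i / (y + P.lam i * P.load i) < P.lam i / (x + P.lam i * P.load i) := by
    gcongr
  refine max_lt ?_ (h4.trans_le (le_max_right _ _))
  rcases le_or_gt (P.lam i * (1 - P.load i / P.kappa)) 0 with h5 | h5
  · refine lt_max_of_lt_right ((div_nonpos_of_nonpos_of_nonneg h5 (hx.trans hxy).le).trans_lt ?_)
    positivity
  -- The first branch decreases only for a positive numerator; otherwise it is nonpositive and the
  -- second branch dominates.
  · exact lt_max_of_lt_left (div_lt_div_of_pos_left h5 hx hxy)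

lemma IsStationary.unique {s vbar s' vbar' : Fin n → ℝ} (h : P.IsStationary s vbar)
    (hG : 0 < ∑ j, P.deficit (P.matchings s vbar) j) (h' : P.IsStationary s' vbar')
    (hG' : 0 < ∑ j, P.deficit (P.matchings s' vbar') j) : s = s' ∧ vbar = vbar' := by
  have key : ∀ i : Fin n, ∑ j, P.deficit (P.matchings s vbar) j
      = ∑ j, P.deficit (P.matchings s' vbar') j := by
    intro i
    have : Nonempty (Fin n) := ⟨i⟩
    have e := deficitRatio_eq_one h hG
    have e' := deficitRatio_eq_one h' hG'
    rcases lt_trichotomy (∑ j, P.deficit (P.matchings s vbar) j)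
      (∑ j, P.deficit (P.matchings s' vbar') j) with hlt | heq | hlt
    · linarith [deficitRatio_lt (P := P) hG hlt]
    · exact heq
    · linarith [deficitRatio_lt (P := P) hG' hlt]
  refine ⟨funext fun i => ?_, funext fun i => ?_⟩
  · rw [(h.eq_smin hG i).1, (h'.eq_smin hG' i).1]
  · rw [(h.eq_alloc hG i).2, (h'.eq_alloc hG' i).2, key i]

lemma isStationary_alloc {x : ℝ} (hx : 0 < x) (h : P.deficitRatio x = 1) :
    P.IsStationary P.smin (P.alloc x) := by
  have hk := P.one_div_kappa_pos
  have hden : ∀ i, 0 < x + P.lam i * P.load i := fun i => by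
    have h1 := P.lam_pos i
    have h2 := P.load_pos i
    positivity
  have hpos : ∀ i, 0 < P.alloc x i := fun i => lt_min hk (div_pos (P.lam_pos i) (hden i))
  have hle : ∀ i, P.alloc x i * (x + P.lam i * P.load i) ≤ P.lam i := fun i =>
    (le_div_iff₀ (hden i)).1 (min_le_right _ _)
  have hneg : ∀ i, P.matchings P.smin (P.alloc x) i < 0 := fun i => by
    rw [matchings, matching_smin]
    have h1 := P.lam_pos i
    have h2 := hle i
    have h3 := mul_pos (hpos i) hx
    by_contra h4
    nlinarith
  have hd : ∀ i, P.deficit (P.matchings P.smin (P.alloc x)) i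
      = P.lam i * (1 - P.load i * P.alloc x i) := fun i => by
    rw [P.deficit_of_nonpos (hneg i).le, matchings, matching_smin]
    ring
  have hG : ∑ i, P.deficit (P.matchings P.smin (P.alloc x)) i = x := by
    rw [Finset.sum_congr rfl fun i _ => (hd i).trans (deficit_alloc hx i), ← mul_sum]
    change x * P.deficitRatio x = x
    rw [h, mul_one]
  refine ⟨fun i => le_rfl, ⟨fun i => ⟨(hpos i).le, min_le_left _ _⟩, ?_⟩, fun i => ⟨?_, ?_⟩⟩
  -- Each `x * alloc x i` is at most the deficit of `i`, and the deficits sum to `x`.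
  · have : x * ∑ i, P.alloc x i ≤ x * 1 := by
      rw [mul_one, mul_sum]
      refine (sum_le_sum fun i _ => ?_ :
        ∑ i, x * P.alloc x i ≤ ∑ i, P.deficit (P.matchings P.smin (P.alloc x)) i).trans hG.le
      rw [hd]
      linarith [hle i]
    exact le_of_mul_le_mul_left this hx
  · have := hneg i
    unfold matchings at this
    simp only [odeS, zS, if_true]
    rw [max_eq_left (by linarith)]
    ring
  · unfold odeV zV
    rw [Phi_eq, hG, hd, if_neg (hpos i).ne']
    rcases min_choice (1 / (P.kappa : ℝ)) (P.lam i / (x + P.lam i * P.load i)) with h1 | h1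
    · have h2 : P.alloc x i = 1 / P.kappa := h1
      rw [if_pos h2, max_eq_left]
      · ring
      · linarith [hle i]
    · have h2 : P.alloc x i * (x + P.lam i * P.load i) = P.lam i := by
        rw [alloc, h1, div_mul_cancel₀ _ (hden i).ne']
      have h3 : P.lam i * (1 - P.load i * P.alloc x i) - P.alloc x i * x = 0 := by linarith
      rw [h3]
      simp

/-- The degenerate case: every matching function vanishes, so there is no deficit and no drift. -/
lemma isStationary_inv_load (h : ∀ i, (P.kappa : ℝ) ≤ P.load i) (hsum : ∑ i, 1 / P.load i ≤ 1) :
    P.IsStationary P.smin (fun i => 1 / P.load i) := by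
  have hf : ∀ i, P.matching i (P.smin i) (P.kappa * (1 / P.load i)) = 0 := fun i => by
    rw [matching_smin, mul_one_div_cancel (P.load_pos i).ne', sub_self]
  have hd : ∀ i, P.deficit (P.matchings P.smin fun i => 1 / P.load i) i = 0 := fun i => by
    rw [P.deficit_of_nonpos (hf i).le, matchings, hf i, mul_zero, neg_zero]
  refine ⟨fun i => le_rfl, ⟨fun i => ⟨(one_div_pos.2 (P.load_pos i)).le,
    one_div_le_one_div_of_le P.kappa_cast_pos (h i)⟩, hsum⟩, fun i => ⟨?_, ?_⟩⟩
  · simp only [odeS, zS, hf i]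
    simp
  · unfold odeV zV
    rw [Phi_eq]
    simp only [hd]
    simp

lemma continuousOn_deficitRatio : ContinuousOn P.deficitRatio (Set.Ioi 0) := by
  refine continuousOn_finsetSum _ fun i _ => ContinuousOn.sup ?_ ?_
  · exact continuousOn_const.div continuousOn_id fun x hx => ne_of_gt hx
  · refine continuousOn_const.div (by fun_prop) fun x hx => ?_
    have h1 := P.lam_pos i
    have h2 := P.load_pos i
    have h3 : (0 : ℝ) < x := hx
    positivity

lemma deficitRatio_sum_lam_le [Nonempty (Fin n)] : P.deficitRatio (∑ i, P.lam i) ≤ 1 := by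
  have hL : 0 < ∑ i, P.lam i := sum_pos (fun i _ => P.lam_pos i) univ_nonempty
  rw [← div_self hL.ne', sum_div]
  refine sum_le_sum fun i _ => max_le ?_ ?_
  · have h1 := P.lam_pos i
    have h2 := div_pos (P.load_pos i) P.kappa_cast_pos
    gcongr
    nlinarith
  · have h1 := P.lam_pos i
    have h2 := mul_pos h1 (P.load_pos i)
    gcongr
    linarith

variable (P)

lemma exists_isStationary : ∃ s vbar : Fin n → ℝ, P.IsStationary s vbar := by
  rcases isEmpty_or_nonempty (Fin n) with hn | hn
  · exact ⟨fun _ => 0, fun _ => 0, fun i => hn.elim i, ⟨fun i => hn.elim i, by simp⟩,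
      fun i => hn.elim i⟩
  have hL : 0 < ∑ i, P.lam i := sum_pos (fun i _ => P.lam_pos i) univ_nonempty
  by_cases hex : ∃ x, 0 < x ∧ x ≤ ∑ i, P.lam i ∧ 1 ≤ P.deficitRatio x
  · obtain ⟨x, hx, hxL, h1⟩ := hex
    obtain ⟨y, hy, hy1⟩ := intermediate_value_Icc' hxL
      (continuousOn_deficitRatio.mono fun z hz => lt_of_lt_of_le hx hz.1)
      ⟨deficitRatio_sum_lam_le, h1⟩
    exact ⟨_, _, isStationary_alloc (hx.trans_le hy.1) hy1⟩
  -- Letting `x → 0`, the two branches of the maximum in `deficitRatio x < 1` give the two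
  -- hypotheses of `isStationary_inv_load`.
  · push Not at hex
    have hev : ∀ᶠ x in 𝓝[>] (0 : ℝ), 0 < x ∧ P.deficitRatio x < 1 := by
      filter_upwards [Ioc_mem_nhdsGT hL] with x hx using ⟨hx.1, hex x hx.1 hx.2⟩
    refine ⟨_, _, isStationary_inv_load (P := P) (fun i => ?_) ?_⟩
    · have hlim : Tendsto (fun x : ℝ => x) (𝓝[>] 0) (𝓝 0) :=
        tendsto_nhdsWithin_of_tendsto_nhds tendsto_id
      have h0 : P.lam i * (1 - P.load i / P.kappa) ≤ 0 := by
        refine ge_of_tendsto hlim (hev.mono fun x hx => ?_)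
        have h2 : P.lam i * (1 - P.load i / P.kappa) / x ≤ P.deficitRatio x := by
          refine (le_max_left _ (P.lam i / (x + P.lam i * P.load i))).trans
            (single_le_sum (f := fun i => max (P.lam i * (1 - P.load i / P.kappa) / x)
              (P.lam i / (x + P.lam i * P.load i))) (fun j _ => ?_) (mem_univ i))
          have h1 := P.lam_pos j
          have h2 := P.load_pos j
          have h3 := hx.1
          exact le_max_of_le_right (by positivity)
        have h3 := (div_lt_one hx.1).1 (h2.trans_lt hx.2)
        exact h3.le
      have h1 : 1 ≤ P.load i / P.kappa := by
        by_contra h2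
        nlinarith [P.lam_pos i]
      exact (one_le_div P.kappa_cast_pos).1 h1
    · have hlim : Tendsto (fun x : ℝ => ∑ i, P.lam i / (x + P.lam i * P.load i)) (𝓝[>] 0)
          (𝓝 (∑ i, 1 / P.load i)) := by
        refine tendsto_finsetSum _ fun i _ => ?_
        have h1 := P.lam_pos i
        have h2 := P.load_pos i
        have : 1 / P.load i = P.lam i / (0 + P.lam i * P.load i) := by field_simp; simp
        rw [this]
        refine tendsto_nhdsWithin_of_tendsto_nhds (ContinuousAt.tendsto
          (f := fun x : ℝ => P.lam i / (x + P.lam i * P.load i)) (x := 0) ?_)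
        refine continuousAt_const.div (by fun_prop) ?_
        positivity
      refine le_of_tendsto hlim (hev.mono fun x hx => le_trans ?_ hx.2.le)
      exact sum_le_sum fun i _ => le_max_right _ _

end CPUSystem

end

noncomputable section

open Finset

/-! ### Schedules -/

/-- Boundedness makes the `sSup` in `lastIndex` a genuine maximum instead of the default value 0. -/
lemma bddAbove_setOf_le {t : ℕ → ℝ} (ht : Tendsto t atTop atTop) (x : ℝ) :
    BddAbove {k | t k ≤ x} := by
  obtain ⟨N, hN⟩ := eventually_atTop.1 (ht.eventually_gt_atTop x)
  refine ⟨N, fun k hk => ?_⟩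
  by_contra h
  exact absurd (hN k (not_le.1 h).le) (not_lt.2 hk)

lemma le_lastIndex {t : ℕ → ℝ} (ht : Tendsto t atTop atTop) {x : ℝ} {k : ℕ} (h : t k ≤ x) :
    k ≤ lastIndex t x :=
  le_csSup (bddAbove_setOf_le ht x) h

lemma apply_lastIndex_le {t : ℕ → ℝ} (ht : Tendsto t atTop atTop) {x : ℝ} {k : ℕ} (h : t k ≤ x) :
    t (lastIndex t x) ≤ x :=
  Nat.sSup_mem (s := {k | t k ≤ x}) ⟨k, h⟩ (bddAbove_setOf_le ht x)

lemma tendsto_lastIndex {t : ℕ → ℝ} (ht : Tendsto t atTop atTop) :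
    Tendsto (lastIndex t) atTop atTop :=
  tendsto_atTop.2 fun k => (eventually_ge_atTop (t k)).mono fun _ hx => le_lastIndex ht hx

namespace IsSchedule

variable {n Nbar : ℕ} {rm : ℕ → ℝ} {app : Fin n → ℕ → ℝ}

lemma le_lastIndex_app (h : IsSchedule Nbar rm app) (i : Fin n) (k : ℕ) :
    k ≤ lastIndex rm (app i k) := by
  induction k with
  | zero => exact Nat.zero_le _
  | succ k ih =>
    have := h.one_le_numUpdates i k
    unfold numUpdates at this
    omega

/-- With a manager update between consecutive application updates, the application instants inherit
divergence. -/
lemma rm_le_app (h : IsSchedule Nbar rm app) (i : Fin n) (k : ℕ) : rm k ≤ app i k := by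
  have h0 : rm 0 ≤ app i k := by
    rw [h.rm_zero]
    exact (h.app_nonneg i).trans ((h.app_strictMono i).monotone (Nat.zero_le k))
  exact (h.rm_strictMono.monotone (h.le_lastIndex_app i k)).trans
    (apply_lastIndex_le h.rm_tendsto h0)

lemma app_tendsto (h : IsSchedule Nbar rm app) (i : Fin n) : Tendsto (app i) atTop atTop :=
  tendsto_atTop_mono (h.rm_le_app i) h.rm_tendsto

end IsSchedule

/-- A sequence that loses at least `c > 0` at each step as long as it is above `a` gets to `a`
and stays there. -/
lemma eventually_le_of_step_le {u : ℕ → ℝ} {a c : ℝ} (hc : 0 < c)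
    (h : ∀ᶠ k in atTop, u (k + 1) ≤ max a (u k - c)) : ∀ᶠ k in atTop, u k ≤ a := by
  obtain ⟨K, hK⟩ := eventually_atTop.1 h
  have key : ∀ j : ℕ, u (K + j) ≤ max a (u K - j * c) := by
    intro j
    induction j with
    | zero => simp
    | succ j ih =>
      refine (hK (K + j) (by omega)).trans (max_le (le_max_left _ _) ?_)
      rcases le_max_iff.1 ih with h1 | h1
      · exact le_max_of_le_left (by linarith)
      · refine le_max_of_le_right ?_
        push_cast
        linarith
  obtain ⟨J, hJ⟩ := exists_nat_gt ((u K - a) / c)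
  refine eventually_atTop.2 ⟨K + J, fun k hk => ?_⟩
  obtain ⟨j, rfl⟩ := Nat.exists_eq_add_of_le (show K ≤ k by omega)
  refine (key j).trans (max_le le_rfl ?_)
  have h1 : (J : ℝ) ≤ j := by exact_mod_cast (show J ≤ j by omega)
  have h2 := (div_lt_iff₀ hc).1 hJ
  nlinarith

/-! ### Quantitative overload and its stationary point. -/

namespace CPUSystem

variable {n : ℕ} {P : CPUSystem n}

/-- Quantitative overload: `gap` bounds the total deficit at feasible allocations from below, and
below the level `ζ`, which every allocation ends up respecting, demands are met up to a fraction
`η` and the fairness measure is diagonally dominant. -/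
structure Overloaded (P : CPUSystem n) (gap ζ η : ℝ) : Prop where
  gap_pos : 0 < gap
  level_pos : 0 < ζ
  fraction_le : η ≤ 1 / 2
  gap_add_le : ∀ v, P.Feasible v → gap + ∑ i, P.lam i * P.load i * v i ≤ ∑ i, P.lam i
  lam_lt : ∀ i, P.lam i < ζ * gap
  load_mul_le : ∀ i, P.load i * ζ ≤ η
  dominant : ζ * ∑ i, P.lam i * P.load i < gap

lemma share_pos (P : CPUSystem n) (i : Fin n) : 0 < P.share i :=
  lt_min P.one_div_kappa_pos
    (div_pos (P.lam_pos i) (sum_pos (fun j _ => P.lam_pos j) ⟨i, mem_univ i⟩))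

namespace Overloaded

variable {gap ζ η : ℝ}

lemma gap_le (hP : P.Overloaded gap ζ η) {v f : Fin n → ℝ} (hv : P.Feasible v)
    (hf : ∀ i, f i ≤ P.load i * v i - 1) : gap ≤ ∑ i, P.deficit f i := by
  have h1 := hP.gap_add_le v hv
  have h2 : ∑ i, (P.lam i - P.lam i * P.load i * v i) ≤ ∑ i, P.deficit f i := by
    refine sum_le_sum fun i _ => le_trans ?_ (P.le_deficit f i)
    nlinarith [P.lam_pos i, hf i]
  rw [sum_sub_distrib] at h2
  linarith

lemma sum_deficit_pos (hP : P.Overloaded gap ζ η) {s v : Fin n → ℝ} (h : P.IsStationary s v) :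
    0 < ∑ i, P.deficit (P.matchings s v) i :=
  hP.gap_pos.trans_le (hP.gap_le h.2.1 fun i => P.matching_le (h.1 i) (h.2.1.1 i).1)

lemma existsUnique (hP : P.Overloaded gap ζ η) :
    ∃! p : (Fin n → ℝ) × (Fin n → ℝ), P.IsStationary p.1 p.2 := by
  obtain ⟨s, v, h⟩ := P.exists_isStationary
  refine ⟨(s, v), h, fun p hp => ?_⟩
  have := hp.unique (hP.sum_deficit_pos hp) h (hP.sum_deficit_pos h)
  exact Prod.ext this.1 this.2

lemma stationary_le (hP : P.Overloaded gap ζ η) {s v : Fin n → ℝ} (h : P.IsStationary s v)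
    (i : Fin n) : v i ≤ ζ := by
  have hG := hP.sum_deficit_pos h
  have h2 := hP.gap_le h.2.1 fun i => P.matching_le (h.1 i) (h.2.1.1 i).1
  have hl := P.lam_pos i
  have hb := P.load_pos i
  rw [(h.eq_alloc hG i).2]
  refine (min_le_right _ _).trans ?_
  change gap ≤ ∑ i, P.deficit (P.matchings s v) i at h2
  have h3 : 0 < P.lam i * P.load i := by positivity
  rw [div_le_iff₀ (by linarith)]
  nlinarith [hP.lam_lt i, hP.level_pos]

/-- Each deficit lies between `(1 - η) λ i` and `λ i`, so replacing deficits by weights costs a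
factor `1 - η` either way; `η ≤ 1/2` turns `1 / (1 - η)` into at most `1 + 2 η`. -/
lemma abs_sub_share_le (hP : P.Overloaded gap ζ η) {s v : Fin n → ℝ} (h : P.IsStationary s v)
    (i : Fin n) : |v i - P.share i| ≤ 2 * η * P.share i := by
  have hG := hP.sum_deficit_pos h
  have hη : 0 < η := (mul_pos (P.load_pos i) hP.level_pos).trans_le (hP.load_mul_le i)
  have hη2 := hP.fraction_le
  have hL : 0 < ∑ j, P.lam j := sum_pos (fun j _ => P.lam_pos j) ⟨i, mem_univ i⟩
  have hd : ∀ j, (1 - η) * P.lam j ≤ P.deficit (P.matchings s v) j ∧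
      P.deficit (P.matchings s v) j ≤ P.lam j := fun j => by
    refine ⟨?_, P.deficit_le (P.neg_one_le_matchings h.1 h.2.1 j)⟩
    rw [(h.eq_alloc hG j).1]
    have h1 : P.load j * v j ≤ η :=
      (mul_le_mul_of_nonneg_left (hP.stationary_le h j) (P.load_pos j).le).trans (hP.load_mul_le j)
    nlinarith [P.lam_pos j]
  have hGl : (1 - η) * ∑ j, P.lam j ≤ ∑ j, P.deficit (P.matchings s v) j := by
    rw [mul_sum]
    exact sum_le_sum fun j _ => (hd j).1
  have hGu : ∑ j, P.deficit (P.matchings s v) j ≤ ∑ j, P.lam j := sum_le_sum fun j _ => (hd j).2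
  have hsat := (h.fairOrSaturated hG i).2
  have hk := (h.2.1.1 i).2
  have hv := h.2.1.1 i
  rw [Phi_eq] at hsat
  generalize ∑ j, P.deficit (P.matchings s v) j = G at *
  obtain ⟨hd1, hd2⟩ := hd i
  generalize P.deficit (P.matchings s v) i = g at *
  have hs := share_pos P i
  have hs1 : P.share i ≤ 1 / P.kappa := min_le_left _ _
  have hs2 : P.share i * ∑ j, P.lam j ≤ P.lam i := (le_div_iff₀ hL).1 (min_le_right _ _)
  have hvG : v i * G ≤ g := by
    rcases hsat with h1 | ⟨h1, -⟩ <;> linarith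
  have hup : (1 - η) * v i ≤ P.share i := by
    unfold share
    refine le_min (by nlinarith) ?_
    rw [le_div_iff₀ hL]
    nlinarith [mul_le_mul_of_nonneg_left hGl hv.1]
  have hlow : (1 - η) * P.share i ≤ v i := by
    rcases hsat with h1 | ⟨-, h1⟩
    · have h2 : (1 - η) * P.share i * G ≤ v i * G := by
        nlinarith [mul_le_mul_of_nonneg_left hGu hs.le]
      exact le_of_mul_le_mul_right h2 hG
    · rw [h1]
      nlinarith
  rw [abs_le]
  constructor
  · nlinarith
  · nlinarith

end Overloaded

/-! ### One step of the recursion of the bandwidths -/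

lemma projV_mem (P : CPUSystem n) (x : ℝ) : 0 ≤ P.projV x ∧ P.projV x ≤ 1 / P.kappa :=
  ⟨le_max_left _ _, max_le P.one_div_kappa_pos.le (min_le_left _ _)⟩

lemma projV_le (P : CPUSystem n) {x : ℝ} (hx : 0 ≤ x) : P.projV x ≤ x :=
  max_le hx (min_le_right _ _)

lemma abs_projV_sub_le (P : CPUSystem n) (x y : ℝ) : |P.projV x - P.projV y| ≤ |x - y| := by
  unfold projV
  refine (abs_max_sub_max_le_max _ _ _ _).trans (max_le (by simp) ?_)
  exact (abs_min_sub_min_le_max _ _ _ _).trans (max_le (by simp) le_rfl)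

section Step

variable {ε : ℝ} {v f : Fin n → ℝ}

lemma sum_deficit_le (hf : ∀ i, -1 ≤ f i) : ∑ i, P.deficit f i ≤ ∑ i, P.lam i :=
  sum_le_sum fun i _ => P.deficit_le (hf i)

lemma step_nonneg (hε : 0 < ε) (hεL : ε * ∑ i, P.lam i ≤ 1) (hv : P.Feasible v)
    (hf : ∀ i, -1 ≤ f i) (i : Fin n) : 0 ≤ v i + ε * P.fairness v f i := by
  rw [fairness_eq]
  have h1 := mul_nonneg hε.le (P.deficit_nonneg f i)
  have h2 : ε * ∑ i, P.deficit f i ≤ 1 :=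
    (mul_le_mul_of_nonneg_left (sum_deficit_le hf) hε.le).trans hεL
  have h3 := mul_nonneg (hv.1 i).1 (sub_nonneg.2 h2)
  linarith

lemma feasible_step (hε : 0 < ε) (hεL : ε * ∑ i, P.lam i ≤ 1) (hv : P.Feasible v)
    (hf : ∀ i, -1 ≤ f i) : P.Feasible fun i => P.projV (v i + ε * P.fairness v f i) := by
  refine ⟨fun i => P.projV_mem _, ?_⟩
  refine (sum_le_sum fun i _ => P.projV_le (step_nonneg hε hεL hv hf i)).trans ?_
  have h2 : ε * ∑ i, P.deficit f i ≤ 1 :=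
    (mul_le_mul_of_nonneg_left (sum_deficit_le hf) hε.le).trans hεL
  simp only [fairness_eq]
  rw [sum_add_distrib, ← mul_sum, sum_sub_distrib, ← sum_mul]
  -- The unprojected sum is the convex combination `(1 - ε G) ∑ v + ε G` of `∑ v` and 1.
  nlinarith [mul_nonneg (sub_nonneg.2 hv.2) (sub_nonneg.2 h2)]

/-- The recursion decreases `v i` by a fixed amount as long as it exceeds `ζ`. -/
lemma Overloaded.step_le {gap ζ η : ℝ} (hP : P.Overloaded gap ζ η) (hε : 0 < ε)
    (hεL : ε * ∑ i, P.lam i ≤ 1) (hv : P.Feasible v) (hf : ∀ i, -1 ≤ f i)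
    (hf' : ∀ i, f i ≤ P.load i * v i - 1) (i : Fin n) :
    P.projV (v i + ε * P.fairness v f i) ≤ max ζ (v i - ε * (ζ * gap - P.lam i)) := by
  refine (P.projV_le (step_nonneg hε hεL hv hf i)).trans ?_
  have hG := hP.gap_le hv hf'
  have h1 := P.deficit_le (hf i)
  have h2 : ε * ∑ i, P.deficit f i ≤ 1 :=
    (mul_le_mul_of_nonneg_left (sum_deficit_le hf) hε.le).trans hεL
  have hl := hP.lam_lt i
  rw [fairness_eq]
  generalize ∑ i, P.deficit f i = G at *
  have h3 : ε * P.deficit f i ≤ ε * P.lam i := mul_le_mul_of_nonneg_left h1 hε.le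
  have h4 : ε * P.lam i ≤ ε * (ζ * G) :=
    mul_le_mul_of_nonneg_left (hl.le.trans (mul_le_mul_of_nonneg_left hG hP.level_pos.le)) hε.le
  have h5 : ε * (ζ * gap) ≤ ε * (ζ * G) :=
    mul_le_mul_of_nonneg_left (mul_le_mul_of_nonneg_left hG hP.level_pos.le) hε.le
  rcases le_total (v i) ζ with h6 | h6
  · refine le_max_of_le_left ?_
    have := mul_nonneg (sub_nonneg.2 h6) (sub_nonneg.2 h2)
    nlinarith
  · refine le_max_of_le_right ?_
    have := mul_nonneg (sub_nonneg.2 h6) (mul_nonneg hε.le (hP.gap_pos.le.trans hG))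
    nlinarith

/-- At minimum service levels and below the level `ζ`, the recursion of the bandwidths contracts
the distance to the stationary point. -/
lemma Overloaded.abs_step_sub_le {gap ζ η : ℝ} (hP : P.Overloaded gap ζ η) (hε : 0 < ε)
    (hεL : ε * (∑ i, P.lam i + ∑ i, P.lam i * P.load i) ≤ 1) (hv : P.Feasible v)
    (hvζ : ∀ i, v i ≤ ζ) (hf : ∀ i, f i = P.load i * v i - 1) {s w : Fin n → ℝ}
    (h : P.IsStationary s w) {C : ℝ} (hC : ∀ i, |v i - w i| ≤ C) (i : Fin n) :
    |P.projV (v i + ε * P.fairness v f i) - w i|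
      ≤ (1 - ε * (gap - ζ * ∑ i, P.lam i * P.load i)) * C := by
  have hGw := hP.sum_deficit_pos h
  have hgap := hP.gap_le hv fun i => (hf i).le
  have hfl : ∀ i, -1 ≤ f i := fun i => by
    have := mul_nonneg (P.load_pos i).le (hv.1 i).1
    rw [hf]
    linarith
  have hGL := sum_deficit_le (P := P) hfl
  have hdv : ∀ j, P.deficit f j = P.lam j * (1 - P.load j * v j) := fun j => by
    have h1 : P.load j * v j ≤ η :=
      (mul_le_mul_of_nonneg_left (hvζ j) (P.load_pos j).le).trans (hP.load_mul_le j)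
    rw [P.deficit_of_nonpos (by rw [hf]; linarith [hP.fraction_le]), hf]
    ring
  have hdw : ∀ j, P.deficit (P.matchings s w) j = P.lam j * (1 - P.load j * w j) :=
    fun j => (h.eq_alloc hGw j).1
  have hdiff : |∑ j, P.deficit f j - ∑ j, P.deficit (P.matchings s w) j|
      ≤ (∑ j, P.lam j * P.load j) * C := by
    rw [← sum_sub_distrib, sum_mul]
    refine (abs_sum_le_sum_abs _ _).trans (sum_le_sum fun j _ => ?_)
    have h1 := (mul_pos (P.lam_pos j) (P.load_pos j)).le
    have h2 : P.deficit f j - P.deficit (P.matchings s w) j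
        = -(P.lam j * P.load j * (v j - w j)) := by
      rw [hdv, hdw]
      ring
    rw [h2, abs_neg, abs_mul, abs_of_nonneg h1]
    exact mul_le_mul_of_nonneg_left (hC j) h1
  have hlb : P.lam i * P.load i ≤ ∑ j, P.lam j * P.load j :=
    single_le_sum (f := fun j => P.lam j * P.load j)
      (fun j _ => (mul_pos (P.lam_pos j) (P.load_pos j)).le) (mem_univ i)
  have hlb0 := (mul_pos (P.lam_pos i) (P.load_pos i)).le
  have hfix := h.projV_eq hε i
  have hw0 := (h.2.1.1 i).1
  have hwζ := hP.stationary_le h i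
  have hC0 : 0 ≤ C := (abs_nonneg _).trans (hC i)
  conv_lhs => rw [← hfix]
  refine (P.abs_projV_sub_le _ _).trans ?_
  rw [fairness_eq, Phi_eq, hdv i, hdw i]
  generalize ∑ j, P.deficit f j = G at *
  generalize ∑ j, P.deficit (P.matchings s w) j = G' at *
  generalize ∑ j, P.lam j * P.load j = B at *
  have hcoef : 0 ≤ 1 - ε * (G + P.lam i * P.load i) := by
    have := mul_le_mul_of_nonneg_left (add_le_add hGL hlb) hε.le
    linarith
  -- The diagonal factor is at most `1 - ε gap`; the coupling through `G - G'` costs at most `ε ζ ∑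
  -- λ load` times `C`.
  have hsplit : v i + ε * (P.lam i * (1 - P.load i * v i) - v i * G)
      - (w i + ε * (P.lam i * (1 - P.load i * w i) - w i * G'))
      = (1 - ε * (G + P.lam i * P.load i)) * (v i - w i) - ε * w i * (G - G') := by
    ring
  rw [hsplit]
  refine (abs_sub _ _).trans ?_
  rw [abs_mul, abs_mul, abs_of_nonneg hcoef, abs_of_nonneg (mul_nonneg hε.le hw0)]
  have t1 := mul_le_mul_of_nonneg_left (hC i) hcoef
  have t2 := mul_le_mul_of_nonneg_left hdiff (mul_nonneg hε.le hw0)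
  have hB : 0 ≤ B := hlb0.trans hlb
  have t3 : ε * w i * (B * C) ≤ ε * ζ * (B * C) := by gcongr
  have t4 : 0 ≤ ε * (G + P.lam i * P.load i - gap) * C :=
    mul_nonneg (mul_nonneg hε.le (by linarith)) hC0
  nlinarith

end Step

/-! ### Asynchronous trajectories -/

section Async

variable {Nbar : ℕ} {rm : ℕ → ℝ} {app : Fin n → ℕ → ℝ} {ε : ℝ} {s : Fin n → ℕ → ℝ}
  {vbar : ℕ → Fin n → ℝ} {gap ζ η : ℝ}

lemma IsAsyncTrajectory.smin_le (h : P.IsAsyncTrajectory rm app ε s vbar) (i : Fin n) (k : ℕ) :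
    P.smin i ≤ s i k := by
  cases k with
  | zero => exact h.init_s i
  | succ k =>
    rw [h.step_s]
    exact le_max_left _ _

lemma IsAsyncTrajectory.neg_one_le_observed (h : P.IsAsyncTrajectory rm app ε s vbar) {m : ℕ}
    (hv : P.Feasible (vbar m)) (i : Fin n) : -1 ≤ P.observed rm app s vbar m i :=
  P.neg_one_le_matching (h.smin_le i _) (hv.1 i).1

lemma IsAsyncTrajectory.observed_le (h : P.IsAsyncTrajectory rm app ε s vbar) {m : ℕ}
    (hv : P.Feasible (vbar m)) (i : Fin n) :
    P.observed rm app s vbar m i ≤ P.load i * vbar m i - 1 :=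
  P.matching_le (h.smin_le i _) (hv.1 i).1

lemma IsAsyncTrajectory.feasible (h : P.IsAsyncTrajectory rm app ε s vbar) (hε : 0 < ε)
    (hεL : ε * ∑ i, P.lam i ≤ 1) (m : ℕ) : P.Feasible (vbar m) := by
  induction m with
  | zero => exact h.init_v
  | succ m ih =>
    rw [show vbar (m + 1) = _ from funext (h.step_v m)]
    exact feasible_step hε hεL ih (h.neg_one_le_observed ih)

lemma IsAsyncTrajectory.eventually_le_level (h : P.IsAsyncTrajectory rm app ε s vbar)
    (hP : P.Overloaded gap ζ η) (hε : 0 < ε) (hεL : ε * ∑ i, P.lam i ≤ 1) :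
    ∀ᶠ m in atTop, ∀ i, vbar m i ≤ ζ := by
  refine eventually_all.2 fun i => ?_
  refine eventually_le_of_step_le (mul_pos hε (sub_pos.2 (hP.lam_lt i))) (.of_forall fun m => ?_)
  have hv := h.feasible hε hεL m
  rw [h.step_v]
  exact hP.step_le hε hεL hv (h.neg_one_le_observed hv) (h.observed_le hv) i

lemma IsAsyncTrajectory.eventually_eq_smin (h : P.IsAsyncTrajectory rm app ε s vbar)
    (hs : IsSchedule Nbar rm app) (hP : P.Overloaded gap ζ η) (hε : 0 < ε)
    (hεL : ε * ∑ i, P.lam i ≤ 1) (i : Fin n) : ∀ᶠ k in atTop, s i k = P.smin i := by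
  suffices ∀ᶠ k in atTop, s i k ≤ P.smin i from
    this.mono fun k hk => le_antisymm hk (h.smin_le i k)
  refine eventually_le_of_step_le (half_pos hε) ?_
  obtain ⟨M, hM⟩ := eventually_atTop.1 (h.eventually_le_level hP hε hεL)
  refine eventually_atTop.2 ⟨M, fun k hk => ?_⟩
  have hm := hk.trans (hs.le_lastIndex_app i k)
  rw [h.step_s]
  refine max_le_max le_rfl ?_
  generalize lastIndex rm (app i k) = m at *
  have h1 : P.load i * vbar m i ≤ η :=
    (mul_le_mul_of_nonneg_left (hM m hm i) (P.load_pos i).le).trans (hP.load_mul_le i)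
  have h2 := h.observed_le (h.feasible hε hεL m) i
  have h3 : (1 : ℝ) ≤ numUpdates rm (app i) k := by exact_mod_cast hs.one_le_numUpdates i k
  have h4 := hP.fraction_le
  have h5 : (numUpdates rm (app i) k : ℝ) * P.observed rm app s vbar m i ≤ -(1 / 2) := by
    nlinarith
  nlinarith

lemma IsAsyncTrajectory.eventually_observed_eq (h : P.IsAsyncTrajectory rm app ε s vbar)
    (hs : IsSchedule Nbar rm app) (hP : P.Overloaded gap ζ η) (hε : 0 < ε)
    (hεL : ε * ∑ i, P.lam i ≤ 1) :
    ∀ᶠ m in atTop, ∀ i, P.observed rm app s vbar m i = P.load i * vbar m i - 1 := by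
  refine eventually_all.2 fun i => ?_
  have := ((tendsto_lastIndex (hs.app_tendsto i)).comp hs.rm_tendsto).eventually
    (h.eventually_eq_smin hs hP hε hεL i)
  filter_upwards [this] with m hm
  rw [observed, ← matching_smin]
  exact congrArg (fun x => P.matching i x _) hm

lemma Overloaded.asyncConvergesTo (hP : P.Overloaded gap ζ η) {sStar vStar : Fin n → ℝ}
    (hst : P.IsStationary sStar vStar) : P.AsyncConvergesTo sStar vStar := by
  intro Nbar
  have hL : 0 ≤ ∑ i, P.lam i := sum_nonneg fun i _ => (P.lam_pos i).le
  have hB : 0 ≤ ∑ i, P.lam i * P.load i :=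
    sum_nonneg fun i _ => (mul_pos (P.lam_pos i) (P.load_pos i)).le
  -- This bound keeps the diagonal factor of the contraction nonnegative; the `+ 1` keeps the
  -- denominator positive when `n = 0`.
  refine ⟨1 / (∑ i, P.lam i + ∑ i, P.lam i * P.load i + 1), by positivity,
    fun ε hε hε₀ rm app hs s vbar h i => ?_⟩
  rw [lt_div_iff₀ (by positivity)] at hε₀
  have hεLB : ε * (∑ i, P.lam i + ∑ i, P.lam i * P.load i) ≤ 1 := by nlinarith
  have hεL : ε * ∑ i, P.lam i ≤ 1 := by nlinarith [mul_nonneg hε.le hB]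
  constructor
  · refine tendsto_nhds_of_eventually_eq ?_
    rw [(hst.eq_smin (hP.sum_deficit_pos hst) i).1]
    exact h.eventually_eq_smin hs hP hε hεL i
  obtain ⟨M, hM⟩ := eventually_atTop.1
    ((h.eventually_le_level hP hε hεL).and (h.eventually_observed_eq hs hP hε hεL))
  set q := 1 - ε * (gap - ζ * ∑ i, P.lam i * P.load i) with hq
  have hq1 : q < 1 := by
    have := mul_pos hε (sub_pos.2 hP.dominant)
    linarith
  have hq0 : 0 ≤ q := by
    have h1 := hP.gap_le hst.2.1 fun i => P.matching_le (hst.1 i) (hst.2.1.1 i).1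
    have h2 := sum_deficit_le (P := P) (P.neg_one_le_matchings hst.1 hst.2.1)
    have h3 := mul_le_mul_of_nonneg_left (h1.trans h2) hε.le
    have h4 := mul_nonneg hε.le (mul_nonneg hP.level_pos.le hB)
    linarith
  have key : ∀ j i, |vbar (M + j) i - vStar i| ≤ q ^ j * 1 := by
    intro j
    induction j with
    | zero =>
      intro i
      have h1 := (h.feasible hε hεL M).1 i
      have h2 := hst.2.1.1 i
      have h3 : 1 / (P.kappa : ℝ) ≤ 1 :=
        (div_le_one P.kappa_cast_pos).2 (by exact_mod_cast P.kappa_pos)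
      simp only [add_zero, pow_zero, mul_one]
      rw [abs_le]
      constructor <;> linarith
    | succ j ih =>
      intro i
      obtain ⟨h1, h2⟩ := hM (M + j) (by omega)
      rw [← add_assoc, h.step_v, pow_succ', mul_assoc]
      exact hP.abs_step_sub_le hε hεLB (h.feasible hε hεL _) h1 h2 hst ih i
  have hlim : Tendsto (fun j => vbar (M + j) i) atTop (𝓝 (vStar i)) := by
    rw [tendsto_iff_norm_sub_tendsto_zero]
    refine squeeze_zero (fun _ => norm_nonneg _) (fun j => key j i) ?_
    simpa using tendsto_pow_atTop_nhds_zero_of_lt_one hq0 hq1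
  rw [← tendsto_add_atTop_iff_nat (f := fun m => vbar m i) M]
  simpa only [add_comm] using hlim

end Async

/-! ### The two asymptotic regimes -/

lemma Feasible.le_one {v : Fin n → ℝ} (hv : P.Feasible v) (i : Fin n) : v i ≤ 1 :=
  (hv.1 i).2.trans ((div_le_one P.kappa_cast_pos).2 (by exact_mod_cast P.kappa_pos))

/-- Here `ζ = 2` exceeds every feasible allocation, so the level imposes nothing; small loads alone
give the gap and the dominance. -/
lemma overloaded_of_load_lt [Nonempty (Fin n)] {η : ℝ} (hη : η ≤ 1 / 2)
    (h : ∀ i, P.load i < η / 2) :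
    P.Overloaded ((1 - η / 2) * ∑ i, P.lam i) 2 η := by
  have hL : 0 < ∑ i, P.lam i := sum_pos (fun i _ => P.lam_pos i) univ_nonempty
  have hB : ∑ i, P.lam i * P.load i ≤ η / 2 * ∑ i, P.lam i := by
    rw [mul_sum]
    refine sum_le_sum fun i _ => ?_
    nlinarith [h i, P.lam_pos i]
  refine ⟨mul_pos (by linarith) hL, two_pos, hη, fun v hv => ?_, fun i => ?_,
    fun i => by linarith [h i], by nlinarith⟩
  · have : ∑ i, P.lam i * P.load i * v i ≤ ∑ i, P.lam i * P.load i := by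
      refine sum_le_sum fun i _ => ?_
      exact mul_le_of_le_one_right (mul_pos (P.lam_pos i) (P.load_pos i)).le (hv.le_one i)
    linarith
  · have : P.lam i ≤ ∑ i, P.lam i := single_le_sum (fun j _ => (P.lam_pos j).le) (mem_univ i)
    nlinarith

/-- The demand met is at most `A ∑ v ≤ A`, whereas the weights sum to at least `lam₀ * n`. The level
makes `ζ * gap = 2`, above every weight. -/
lemma overloaded_of_card {lam₀ A η : ℝ} (hη : η ≤ 1 / 2) (hA : 0 ≤ A) (hlam : ∀ i, lam₀ ≤ P.lam i)
    (hload : ∀ i, P.load i ≤ A) (hgap : 0 < lam₀ * n - A) (hlevel : 2 * A ≤ η * (lam₀ * n - A))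
    (hdom : 2 * (n * A) < (lam₀ * n - A) ^ 2) :
    P.Overloaded (lam₀ * n - A) (2 / (lam₀ * n - A)) η := by
  refine ⟨hgap, by positivity, hη, fun v hv => ?_, fun i => ?_, fun i => ?_, ?_⟩
  · have h1 : lam₀ * n ≤ ∑ i, P.lam i := by
      have := card_nsmul_le_sum univ P.lam lam₀ fun i _ => hlam i
      simpa [mul_comm] using this
    have h2 : ∑ i, P.lam i * P.load i * v i ≤ ∑ i, A * v i := by
      refine sum_le_sum fun i _ => mul_le_mul_of_nonneg_right ?_ (hv.1 i).1
      nlinarith [P.lam_pos i, P.lam_le_one i, P.load_pos i, hload i]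
    rw [← mul_sum] at h2
    nlinarith [hv.2]
  · rw [div_mul_cancel₀ _ hgap.ne']
    linarith [P.lam_le_one i]
  · rw [mul_div_assoc', div_le_iff₀ hgap]
    linarith [hload i]
  · have h2 : ∑ i, P.lam i * P.load i ≤ n * A := by
      have := sum_le_card_nsmul univ (fun i => P.lam i * P.load i) A fun i _ => by
        nlinarith [P.lam_pos i, P.lam_le_one i, P.load_pos i, hload i]
      simpa using this
    rw [div_mul_eq_mul_div, div_lt_iff₀ hgap]
    nlinarith

lemma Overloaded.conclusion {gap ζ η δ : ℝ} (hP : P.Overloaded gap ζ η) (hδ : 2 * η < δ) :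
    (∃! p : (Fin n → ℝ) × (Fin n → ℝ), P.IsStationary p.1 p.2) ∧
      ∀ s vbar : Fin n → ℝ, P.IsStationary s vbar →
        (∀ i, s i = P.smin i ∧ |vbar i - P.share i| < δ * P.share i) ∧
        P.AsyncConvergesTo s vbar :=
  ⟨hP.existsUnique, fun _ _ h => ⟨fun i => ⟨(h.eq_smin (hP.sum_deficit_pos h) i).1,
    (hP.abs_sub_share_le h i).trans_lt (mul_lt_mul_of_pos_right hδ (share_pos P i))⟩,
    hP.asyncConvergesTo h⟩⟩

end CPUSystem

end

/-- Asynchronous convergence. In the case of many applications the share itself tends to `0`, so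
the limit is stated for the relative error (which bounds the absolute one, as the share is at
most `1`). -/
theorem theorem2 :
    -- 1. existence and characterization of the stationary points under (H1) or (H2)
    (∀ (n : ℕ) (P : CPUSystem n), P.H1 ∨ P.H2 →
      (∃ s vbar : Fin n → ℝ, P.IsStationary s vbar) ∧
      ∀ s vbar : Fin n → ℝ, P.IsStationary s vbar → P.FairOrSaturated s vbar) ∧
    -- 2. case (i): `β_i κ / smin_i → 0` for all `i`
    (∀ (n : ℕ) (δ : ℝ), 0 < δ → ∃ η : ℝ, 0 < η ∧ ∀ P : CPUSystem n,
      (∀ i, P.beta i * P.kappa / P.smin i < η) →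
      (∃! p : (Fin n → ℝ) × (Fin n → ℝ), P.IsStationary p.1 p.2) ∧
      ∀ s vbar : Fin n → ℝ, P.IsStationary s vbar →
        (∀ i, s i = P.smin i ∧ |vbar i - P.share i| < δ) ∧
        P.AsyncConvergesTo s vbar) ∧
    -- 2. case (ii): `n → ∞`
    (∀ (lam₀ A δ : ℝ), 0 < lam₀ → 0 < δ → ∃ n₀ : ℕ, ∀ n : ℕ, n₀ ≤ n → ∀ P : CPUSystem n,
      (∀ i, lam₀ ≤ P.lam i) → (∀ i, P.beta i * P.kappa / P.smin i ≤ A) →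
      (∃! p : (Fin n → ℝ) × (Fin n → ℝ), P.IsStationary p.1 p.2) ∧
      ∀ s vbar : Fin n → ℝ, P.IsStationary s vbar →
        (∀ i, s i = P.smin i ∧ |vbar i - P.share i| < δ * P.share i) ∧
        P.AsyncConvergesTo s vbar) := by

  refine ⟨fun n P hP => ⟨P.exists_isStationary, fun s vbar h =>
    h.fairOrSaturated_of_matchings_neg (h.matchings_neg hP)⟩, ?_, ?_⟩
  · intro n δ hδ
    rcases isEmpty_or_nonempty (Fin n) with hn | hn
    · refine ⟨1, one_pos, fun P _ => ⟨?_, fun s vbar _ => ⟨hn.elim, fun _ =>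
        ⟨1, one_pos, fun _ _ _ _ _ _ _ _ _ => hn.elim⟩⟩⟩⟩
      obtain ⟨s, v, h⟩ := P.exists_isStationary
      exact ⟨(s, v), h, fun _ _ => Subsingleton.elim _ _⟩
    · obtain ⟨η, hη, hη'⟩ := exists_between (show 0 < min (1 / 2) (δ / 2) by positivity)
      obtain ⟨h1, h2⟩ := lt_min_iff.1 hη'
      refine ⟨η / 2, half_pos hη, fun P hP => ?_⟩
      obtain ⟨hu, hs⟩ := (CPUSystem.overloaded_of_load_lt h1.le hP).conclusion
        (show 2 * η < δ by linarith)
      refine ⟨hu, fun s vbar h => ⟨fun i => ⟨((hs s vbar h).1 i).1, ?_⟩, (hs s vbar h).2⟩⟩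
      refine ((hs s vbar h).1 i).2.trans_le (mul_le_of_le_one_right hδ.le ?_)
      exact (min_le_left _ _).trans
        ((div_le_one P.kappa_cast_pos).2 (by exact_mod_cast P.kappa_pos))
  · intro lam₀ A δ hlam₀ hδ
    obtain ⟨η, hη, hη'⟩ := exists_between (show 0 < min (1 / 2) (δ / 2) by positivity)
    obtain ⟨h1, h2⟩ := lt_min_iff.1 hη'
    -- The summands ensure in turn `gap ≥ lam₀ * n / 2`, the fraction bound and the dominance. The
    -- absolute value is needed because `A ≥ 0` is known only once an application exists, hence `n₀
    -- + 1` below.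
    obtain ⟨n₀, hn₀⟩ := exists_nat_gt (2 * |A| / lam₀ + 4 * |A| / (η * lam₀) + 8 * |A| / lam₀ ^ 2)
    refine ⟨n₀ + 1, fun n hn P hlam hload => ?_⟩
    have hA : 0 ≤ A := (P.load_pos ⟨0, by omega⟩).le.trans (hload _)
    rw [abs_of_nonneg hA] at hn₀
    have hn' : (n₀ : ℝ) ≤ n := by exact_mod_cast (show n₀ ≤ n by omega)
    have e1 : 0 ≤ 2 * A / lam₀ := by positivity
    have e2 : 0 ≤ 4 * A / (η * lam₀) := by positivity
    have e3 : 0 ≤ 8 * A / lam₀ ^ 2 := by positivity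
    have f1 := (div_lt_iff₀ hlam₀).1 (show 2 * A / lam₀ < n by linarith)
    have f2 := (div_lt_iff₀ (by positivity)).1 (show 4 * A / (η * lam₀) < n by linarith)
    have f3 := (div_lt_iff₀ (by positivity)).1 (show 8 * A / lam₀ ^ 2 < n by linarith)
    have hnpos : (0 : ℝ) < n := by exact_mod_cast (show 0 < n by omega)
    have hg : lam₀ * n / 2 ≤ lam₀ * n - A := by linarith
    have hg0 : 0 < lam₀ * n / 2 := by positivity
    refine (CPUSystem.overloaded_of_card h1.le hA hlam hload (by linarith) ?_ ?_).conclusion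
      (show 2 * η < δ by linarith)
    · nlinarith
    · have := pow_le_pow_left₀ hg0.le hg 2
      nlinarith
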